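/- \textbf{Setting.} A component code is an $(n,k)$ binary linear block code with a chosen full-rank generator matrix $\mathbf G$ and minimum distance $d_{\min}\ge 2$. For $0\le g\le n$, $0\le h\le k$ let $\tilde e_{g,h}$ be the sum of the ranks of all submatrices of $[\mathbf G\,|\,\mathbf I_k]$ obtained by selecting $g$ columns of $\mathbf G$ and $h$ columns of $\mathbf I_k$, and let $\tilde e_g=\tilde e_{g,0}$. Under MAP erasure correction at the node, the EXIT function of the code used as a variable node (VN), over an extrinsic BEC with erasure probability $p$ and a communication BEC with erasure probability $q$, is $$I_E(p,q)=1-\frac1n\sum_{t=0}^{n-1}\sum_{z=0}^{k}\big[(n-t)\tilde e_{n-t,k-z}-(t+1)\tilde e_{n-t-1,k-z}\big]p^t(1-p)^{n-t-1}q^z(1-q)^{k-z},$$ and the EXIT function of the code used as a check node (CN) is $$I_E(p)=1-\frac1n\sum_{t=0}^{n-1}\big[(n-t)\tilde e_{n-t}-(t+1)\tilde e_{n-t-1}\big]p^t(1-p)^{n-t-1}.$$ A D-GLDPC ensemble consists of finitely many VN types and CN types, which are component codes, with edge fractions $\lambda_i\ge0$, $\rho_i\ge0$, $\sum_i\lambda_i=\sum_i\rho_i=1$.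 Put $I_{E,V}(p,q)=\sum_i\lambda_i I^{(i)}_{E,V}(p,q)$ and $I_{E,C}(p)=\sum_i\rho_i I^{(i)}_{E,C}(p)$. Its iterative decoding threshold over the BEC is $$q^*=\sup\{q\in[0,1]: p_\ell\to0\},\qquad p_0=1,\quad p_{\ell+1}=1-I_{E,C}\big(1-I_{E,V}(p_\ell,q)\big).$$ Write $I_A=1-p$ for the a priori information. The VND EXIT curve is $I_A\mapsto I_{E,V}(1-I_A,q)$; the inverse CND EXIT curve is the inverse of $I_A\mapsto I_{E,C}(1-I_A)$ on $[0,1]$. The two curves are \emph{tangent} at a point of the domain of the inverse CND EXIT curve if they have there the same value and the same (at an endpoint, one-sided) finite derivative. For a component code let $A_2$ be the number of its weight-2 codewords and $A_{2,u}$ the number of those generated by information words of weight $u$. Put $$C=\sum_{i:\,d_{\min}=2}\rho_i\frac{2A_2^{(i)}}{n_i},\qquad P(x)=\sum_{i:\,d_{\min}=2}\lambda_i\sum_{u=1}^{k_i}\frac{2A^{(i)}_{2,u}}{n_i}\,x^u ,$$ where the first sum is over the CN types and the second over the VN types with minimum distance $2$. \textbf{Statement.} Suppose that a D-GLDPC ensemble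 satisfies the derivative matching condition, in either of the following two forms: (a) for $q=q^*$ the VND EXIT curve and the inverse CND EXIT curve have the same derivative at $I_A=1$ (i.e. $p=0$); (b) as $q$ increases from $0$, the first tangency between the two curves occurs at $I_A=1$: there is $q_1\in[0,1]$ such that for $q=q_1$ the curves are tangent at $I_A=1$, while for $0\le q<q_1$ they are tangent nowhere. Then $C>0$, $P$ is a strictly increasing bijection of $[0,\infty)$ onto itself, and the stability bound $q^*\le P^{-1}(1/C)$ is attained with equality: $$q^*=P^{-1}(1/C).$$ -/

import Mathlib

open Set Filter Topology

/-- The minimum distance of the binary linear code generated by the rows of `G`: the least Hamming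
weight of a nonzero codeword `u G`. (It is `0` by convention when there is no nonzero codeword.) -/
noncomputable def codeMinDist {k n : ℕ} (G : Matrix (Fin k) (Fin n) (ZMod 2)) : ℕ :=
  sInf {w : ℕ | ∃ u : Fin k → ZMod 2,
    Matrix.vecMul u G ≠ 0 ∧ w = hammingNorm (Matrix.vecMul u G)}

/-- An `(n, k)` binary linear block component code, given with a chosen generator matrix `G` of
full rank `k`, and with minimum distance at least `2`. (The last field forces `1 ≤ k` and
`2 ≤ n`.) -/
structure ComponentCode where
  n : ℕ
  k : ℕ
  G : Matrix (Fin k) (Fin n) (ZMod 2)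
  rank_eq : G.rank = k
  two_le_minDist : 2 ≤ codeMinDist G

namespace ComponentCode

/-- Minimum distance. -/
noncomputable def dmin (c : ComponentCode) : ℕ := codeMinDist c.G

/-- Un-normalized information function: the sum of the ranks of all the submatrices obtained by
selecting `g` columns of `G`. -/
noncomputable def infoFun (c : ComponentCode) (g : ℕ) : ℕ :=
  ∑ S ∈ (Finset.univ : Finset (Fin c.n)).powersetCard g,
    (c.G.submatrix id (fun j : S => (j : Fin c.n))).rank

/-- Un-normalized split information function: the sum of the ranks of all the submatrices
`[G_S | I_T]` of `[G | I_k]` obtained by selecting `g` columns of `G` and `h` columns of the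
`k × k` identity matrix. -/
noncomputable def splitInfoFun (c : ComponentCode) (g h : ℕ) : ℕ :=
  ∑ S ∈ (Finset.univ : Finset (Fin c.n)).powersetCard g,
    ∑ T ∈ (Finset.univ : Finset (Fin c.k)).powersetCard h,
      (Matrix.fromCols
        (c.G.submatrix id (fun j : S => (j : Fin c.n)))
        ((1 : Matrix (Fin c.k) (Fin c.k) (ZMod 2)).submatrix id
          (fun j : T => (j : Fin c.k)))).rank

/-- EXIT function of the component code used as a check node with MAP erasure correction, the
extrinsic channel being a BEC with erasure probability `p`. -/
noncomputable def exitCN (c : ComponentCode) (p : ℝ) : ℝ :=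
  1 - (1 / (c.n : ℝ)) * ∑ t ∈ Finset.range c.n,
    (((c.n : ℝ) - t) * (c.infoFun (c.n - t) : ℝ)
        - ((t : ℝ) + 1) * (c.infoFun (c.n - t - 1) : ℝ))
      * p ^ t * (1 - p) ^ (c.n - t - 1)

/-- EXIT function of the component code (with its chosen generator matrix) used as a variable node
with MAP erasure correction, the extrinsic channel being a BEC with erasure probability `p` and the
communication channel a BEC with erasure probability `q`. -/
noncomputable def exitVN (c : ComponentCode) (p q : ℝ) : ℝ :=
  1 - (1 / (c.n : ℝ)) * ∑ t ∈ Finset.range c.n, ∑ z ∈ Finset.range (c.k + 1),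
    (((c.n : ℝ) - t) * (c.splitInfoFun (c.n - t) (c.k - z) : ℝ)
        - ((t : ℝ) + 1) * (c.splitInfoFun (c.n - t - 1) (c.k - z) : ℝ))
      * p ^ t * (1 - p) ^ (c.n - t - 1) * q ^ z * (1 - q) ^ (c.k - z)

/-- `A₂`: the number of codewords of Hamming weight `2`. -/
noncomputable def A2 (c : ComponentCode) : ℕ :=
  {x : Fin c.n → ZMod 2 |
    hammingNorm x = 2 ∧ ∃ u : Fin c.k → ZMod 2, Matrix.vecMul u c.G = x}.ncard

/-- `A_{2,u}`: the number of codewords of Hamming weight `2` that are generated by information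
words of Hamming weight `u`. -/
noncomputable def A2u (c : ComponentCode) (u : ℕ) : ℕ :=
  {x : Fin c.n → ZMod 2 |
    hammingNorm x = 2 ∧
      ∃ w : Fin c.k → ZMod 2, hammingNorm w = u ∧ Matrix.vecMul w c.G = x}.ncard

/-- `C_i = 2 A₂ / n`. -/
noncomputable def Ci (c : ComponentCode) : ℝ := 2 * (c.A2 : ℝ) / (c.n : ℝ)

/-- `P_i(x) = ∑_{u=1}^{k} (2 A_{2,u} / n) x^u`. -/
noncomputable def Pi (c : ComponentCode) (x : ℝ) : ℝ :=
  ∑ u ∈ Finset.Icc 1 c.k, 2 * (c.A2u u : ℝ) / (c.n : ℝ) * x ^ u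

end ComponentCode

/-- A D-GLDPC code ensemble: finitely many types of variable nodes and of check nodes, with the
fractions `lam i` (resp. `rho i`) of edges towards the variable (resp. check) nodes of type `i`.
Repetition variable nodes and SPC check nodes are particular component codes. -/
structure DGLDPCEnsemble where
  numV : ℕ
  numC : ℕ
  vn : Fin numV → ComponentCode
  cn : Fin numC → ComponentCode
  lam : Fin numV → ℝ
  rho : Fin numC → ℝ
  lam_nonneg : ∀ i, 0 ≤ lam i
  rho_nonneg : ∀ i, 0 ≤ rho i
  sum_lam : ∑ i, lam i = 1
  sum_rho : ∑ i, rho i = 1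

namespace DGLDPCEnsemble

/-- EXIT function of the variable node decoder (VND), as a function of `p`, `q`. -/
noncomputable def exitVND (E : DGLDPCEnsemble) (p q : ℝ) : ℝ :=
  ∑ i, E.lam i * (E.vn i).exitVN p q

/-- EXIT function of the check node decoder (CND), as a function of `p`. -/
noncomputable def exitCND (E : DGLDPCEnsemble) (p : ℝ) : ℝ :=
  ∑ i, E.rho i * (E.cn i).exitCN p

/-- Erasure probability of the messages sent from the check nodes to the variable nodes after `l`
iterations of the iterative decoder, in the limit of infinite code length, over a BEC with erasure
probability `q`. Initially all these messages are erased. -/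
noncomputable def erasureProb (E : DGLDPCEnsemble) (q : ℝ) : ℕ → ℝ
  | 0 => 1
  | l + 1 => 1 - E.exitCND (1 - E.exitVND (erasureProb E q l) q)

/-- The asymptotic iterative decoding threshold `q*` over the BEC: the supremum of the channel
erasure probabilities for which the message erasure probability tends to `0`. -/
noncomputable def threshold (E : DGLDPCEnsemble) : ℝ :=
  sSup {q : ℝ | q ∈ Icc (0 : ℝ) 1 ∧ Tendsto (E.erasureProb q) atTop (𝓝 0)}

/-- The VND EXIT curve as a function of the a priori information `a = 1 - p`. -/
noncomputable def curveV (E : DGLDPCEnsemble) (q a : ℝ) : ℝ := E.exitVND (1 - a) q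

/-- The CND EXIT curve as a function of the a priori information `a = 1 - p`. -/
noncomputable def curveC (E : DGLDPCEnsemble) (a : ℝ) : ℝ := E.exitCND (1 - a)

/-- The domain of the inverse CND EXIT curve: the values taken by the CND EXIT curve. -/
def domInvC (E : DGLDPCEnsemble) : Set ℝ := E.curveC '' Icc 0 1

/-- The inverse CND EXIT curve, i.e. the inverse of `curveC : [0, 1] → domInvC`. -/
noncomputable def invCurveC (E : DGLDPCEnsemble) : ℝ → ℝ :=
  Function.invFunOn E.curveC (Icc 0 1)

/-- At the abscissa `a` the VND EXIT curve for channel parameter `q` and the inverse CND EXIT curve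
are both differentiable, with the same derivative (one-sided at an endpoint). -/
def SameSlope (E : DGLDPCEnsemble) (q a : ℝ) : Prop :=
  ∃ s : ℝ, HasDerivWithinAt (E.curveV q) s E.domInvC a ∧
    HasDerivWithinAt E.invCurveC s E.domInvC a

/-- The derivative matching condition: at the threshold `q = q*`, the derivatives of the VND EXIT
curve and of the inverse CND EXIT curve at `a = 1` (i.e. `p = 0`) are equal. -/
def DerivativeMatching (E : DGLDPCEnsemble) : Prop := E.SameSlope E.threshold 1

/-- The VND EXIT curve for channel parameter `q` is tangent to the inverse CND EXIT curve at the
abscissa `a`. -/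
def TangentAt (E : DGLDPCEnsemble) (q a : ℝ) : Prop :=
  a ∈ E.domInvC ∧ E.curveV q a = E.invCurveC a ∧ E.SameSlope q a

/-- As `q` increases from `0` to `1`, the first occurrence of a tangency between the VND EXIT curve
and the inverse CND EXIT curve appears at `a = 1` (i.e. `p = 0`). -/
def FirstTangencyAtOne (E : DGLDPCEnsemble) : Prop :=
  ∃ q₁ ∈ Icc (0 : ℝ) 1, E.TangentAt q₁ 1 ∧ ∀ q, 0 ≤ q → q < q₁ → ∀ a, ¬ E.TangentAt q a

/-- `C = ∑ ρ_i C_i`, over the check node types with minimum distance `2`. -/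
noncomputable def C (E : DGLDPCEnsemble) : ℝ :=
  ∑ i with (E.cn i).dmin = 2, E.rho i * (E.cn i).Ci

/-- `P(x) = ∑ λ_i P_i(x)`, over the variable node types with minimum distance `2`. -/
noncomputable def P (E : DGLDPCEnsemble) (x : ℝ) : ℝ :=
  ∑ i with (E.vn i).dmin = 2, E.lam i * (E.vn i).Pi x

/-- The inverse of `P` on the nonnegative half-line. -/
noncomputable def Pinv (E : DGLDPCEnsemble) : ℝ → ℝ := Function.invFunOn E.P (Ici 0)

end DGLDPCEnsemble

/-! The quantity `1 - exitVN` is the average over code bits `j` of the probability that `j` is not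
determined by the unerased other code bits and the unerased information bits (`one_sub_exitVN`). So
it increases with `p` and `q`, and it vanishes at `p = 0` because the minimum distance is at least
2. Its slope at `p = 0` counts weight-2 codewords, each weighted by the chance `q ^ u` that its
information word is wholly erased (`hasDerivAt_exitVN_zero`). A check node is the case `q = 1`.
Hence one decoder iteration `step q` fixes `0` with slope `C * P q`.

Equal slopes of the two curves at abscissa `1` mean `P q * C = 1` (`P_mul_C_of_sameSlope`). In form
(a) this holds at the threshold itself, which is the claim once `P` is inverted. In form (b) it
holds at `q₁`, and `threshold_eq_of_first_tangency` shows that `q₁` is the threshold. Above `q₁` the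
slope at `0` exceeds 1 and `0` repels the iteration. Below `q₁` the slope is less than 1, so failure
to converge yields some `p > 0` with `p ≤ step q p`. Lowering `q` to the last value for which such a
`p` exists makes the graph of `step q` touch the diagonal from below, at an interior point. There
the two curves are tangent (`exists_tangentAt`), earlier than `q₁` allows. -/

/-! ### Averages over independent erasures -/

/-- The mean of `ψ S`, where `S ⊆ X` is the random set of the elements that are not erased when
every element of `X` is erased independently with probability `p`. -/
noncomputable def erasureMean {α : Type*} (X : Finset α) (ψ : Finset α → ℝ) (p : ℝ) : ℝ :=
  ∑ S ∈ X.powerset, ψ S * (p ^ (X.card - S.card) * (1 - p) ^ S.card)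

namespace erasureMean

variable {α : Type*}

theorem weight_nonneg {p : ℝ} (hp : p ∈ Icc (0 : ℝ) 1) (m l : ℕ) : 0 ≤ p ^ m * (1 - p) ^ l :=
  mul_nonneg (pow_nonneg hp.1 _) (pow_nonneg (sub_nonneg.2 hp.2) _)

theorem mono {X : Finset α} {ψ φ : Finset α → ℝ} {p : ℝ} (hp : p ∈ Icc (0 : ℝ) 1)
    (h : ∀ S ⊆ X, ψ S ≤ φ S) : erasureMean X ψ p ≤ erasureMean X φ p :=
  Finset.sum_le_sum fun S hS =>
    mul_le_mul_of_nonneg_right (h S (Finset.mem_powerset.1 hS)) (weight_nonneg hp _ _)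

theorem const (X : Finset α) (c p : ℝ) : erasureMean X (fun _ => c) p = c := by
  have h := Finset.sum_pow_mul_eq_add_pow (1 - p) p X
  rw [erasureMean, ← Finset.mul_sum]
  simp only [mul_comm (p ^ _)]
  rw [h]
  simp

theorem congr {X : Finset α} {ψ φ : Finset α → ℝ} (h : ∀ S ⊆ X, ψ S = φ S) (p : ℝ) :
    erasureMean X ψ p = erasureMean X φ p :=
  Finset.sum_congr rfl fun S hS => by rw [h S (Finset.mem_powerset.1 hS)]

theorem empty (ψ : Finset α → ℝ) (p : ℝ) : erasureMean ∅ ψ p = ψ ∅ := by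
  simp [erasureMean]

theorem lt_one {X : Finset α} {ψ : Finset α → ℝ} (h1 : ∀ S ⊆ X, ψ S ≤ 1) (hX : ψ X ≤ 0) {p : ℝ}
    (hp0 : 0 ≤ p) (hp : p < 1) : erasureMean X ψ p < 1 := by
  have hp' : p ∈ Icc (0 : ℝ) 1 := ⟨hp0, hp.le⟩
  have h : erasureMean X ψ p < erasureMean X (fun _ => 1) p := by
    refine Finset.sum_lt_sum (fun S hS => ?_) ⟨X, Finset.mem_powerset_self X, ?_⟩
    · exact mul_le_mul_of_nonneg_right (h1 S (Finset.mem_powerset.1 hS)) (weight_nonneg hp' _ _)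
    · have : 0 < (1 - p) ^ X.card := pow_pos (sub_pos.2 hp) _
      rw [Nat.sub_self, pow_zero]
      nlinarith
  rwa [const] at h

variable [DecidableEq α]

/-- Conditioning on whether `a` is erased; this recursion drives the inductions below. -/
theorem insert {X : Finset α} {a : α} (ha : a ∉ X) (ψ : Finset α → ℝ) (p : ℝ) :
    erasureMean (insert a X) ψ p =
      p * erasureMean X ψ p + (1 - p) * erasureMean X (fun S => ψ (insert a S)) p := by
  rw [erasureMean, Finset.sum_powerset_insert ha, erasureMean, erasureMean, Finset.mul_sum,
    Finset.mul_sum]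
  congr 1
  · refine Finset.sum_congr rfl fun S hS => ?_
    have h := Finset.card_le_card (Finset.mem_powerset.1 hS)
    rw [Finset.card_insert_of_notMem ha, Nat.sub_add_comm h, pow_succ]
    ring
  · refine Finset.sum_congr rfl fun S hS => ?_
    have h : a ∉ S := fun h => ha (Finset.mem_powerset.1 hS h)
    rw [Finset.card_insert_of_notMem ha, Finset.card_insert_of_notMem h, Nat.add_sub_add_right,
      pow_succ]
    ring

theorem zero (X : Finset α) (ψ : Finset α → ℝ) : erasureMean X ψ 0 = ψ X := by
  induction X using Finset.induction_on generalizing ψ with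
  | empty => exact empty ψ 0
  | insert a X ha ih => rw [insert ha, ih, ih]; simp

theorem one (X : Finset α) (ψ : Finset α → ℝ) : erasureMean X ψ 1 = ψ ∅ := by
  induction X using Finset.induction_on generalizing ψ with
  | empty => exact empty ψ 1
  | insert a X ha ih => rw [insert ha, ih, ih]; simp

theorem monotone {X : Finset α} {ψ : Finset α → ℝ} (hψ : Antitone ψ) {p p' : ℝ} (hp : 0 ≤ p)
    (hpp : p ≤ p') (hp' : p' ≤ 1) : erasureMean X ψ p ≤ erasureMean X ψ p' := by
  induction X using Finset.induction_on generalizing ψ with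
  | empty => rw [empty, empty]
  | insert a X ha ih =>
    have h1 : Antitone fun S => ψ (Insert.insert a S) :=
      fun S T h => hψ (Finset.insert_subset_insert a h)
    have h2 := ih hψ
    have h3 := ih h1
    have h4 : erasureMean X (fun S => ψ (Insert.insert a S)) p' ≤ erasureMean X ψ p' :=
      mono ⟨hp.trans hpp, hp'⟩ fun S _ => hψ (Finset.subset_insert a S)
    rw [insert ha, insert ha]
    nlinarith [mul_le_mul_of_nonneg_left h2 hp,
      mul_le_mul_of_nonneg_left h3 (sub_nonneg.2 (hpp.trans hp')),
      mul_nonneg (sub_nonneg.2 hpp) (sub_nonneg.2 h4)]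

/-- To first order in `p` only patterns with at most one erasure matter, and the pattern without
erasures contributes nothing since `ψ X = 0`. -/
theorem hasDerivAt_zero (X : Finset α) (ψ : Finset α → ℝ) (hψ : ψ X = 0) :
    HasDerivAt (erasureMean X ψ) (∑ a ∈ X, ψ (X.erase a)) 0 := by
  induction X using Finset.induction_on generalizing ψ with
  | empty =>
    rw [Finset.sum_empty, funext (empty ψ)]
    exact hasDerivAt_const _ _
  | insert a X ha ih =>
    rw [funext (insert ha ψ), Finset.sum_insert ha, Finset.erase_insert ha]
    have h2 := ih (fun S => ψ (Insert.insert a S)) hψ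
    have h1 : DifferentiableAt ℝ (erasureMean X ψ) 0 := by
      unfold erasureMean
      fun_prop
    have h3 := ((hasDerivAt_id (0 : ℝ)).mul h1.hasDerivAt).add
      (((hasDerivAt_id (0 : ℝ)).const_sub 1).mul h2)
    refine h3.congr_deriv ?_
    rw [zero, zero, hψ]
    simp only [id, one_mul, zero_mul, add_zero, sub_zero, mul_zero, zero_add]
    congr 1
    refine Finset.sum_congr rfl fun b hb => ?_
    have hab : a ≠ b := fun h => ha (h ▸ hb)
    rw [Finset.erase_insert_of_ne hab]

/-- The mean is the probability that all of `U` is erased. -/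
theorem disjoint {X U : Finset α} (hU : U ⊆ X) (p : ℝ) :
    erasureMean X (fun S => if Disjoint S U then 1 else 0) p = p ^ U.card := by
  have h : X.powerset.filter (fun S => Disjoint S U) = (X \ U).powerset := by
    ext S
    simp [Finset.subset_sdiff]
  have h1 : p ^ U.card = p ^ U.card * erasureMean (X \ U) (fun _ => 1) p := by
    rw [const, mul_one]
  rw [h1, erasureMean, erasureMean, Finset.mul_sum, ← h, Finset.sum_filter]
  refine Finset.sum_congr rfl fun S hS => ?_
  split_ifs with hd
  · have h2 := Finset.card_le_card (Finset.subset_sdiff.2 ⟨Finset.mem_powerset.1 hS, hd⟩)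
    have h3 := Finset.card_sdiff_add_card_eq_card hU
    have h4 : X.card - S.card = U.card + ((X \ U).card - S.card) := by omega
    rw [h4, pow_add]
    ring
  · simp

end erasureMean

/-! ### Combinatorial identities behind the EXIT formulas -/

theorem erasureMean_eq_sum_range {α : Type*} {X : Finset α} {m : ℕ} (hm : X.card = m)
    (h : Finset α → ℝ) (p : ℝ) :
    ∑ t ∈ Finset.range (m + 1), (∑ S ∈ X.powersetCard (m - t), h S) * (p ^ t * (1 - p) ^ (m - t)) =
      erasureMean X h p := by
  subst hm
  rw [erasureMean, Finset.sum_powerset, ← Finset.sum_range_reflect]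
  refine Finset.sum_congr rfl fun t ht => ?_
  have ht' : t ≤ X.card := Nat.lt_succ_iff.1 (Finset.mem_range.1 ht)
  rw [Finset.sum_mul]
  rw [Nat.add_sub_cancel, Nat.sub_sub_self ht']
  refine Finset.sum_congr rfl fun S hS => ?_
  rw [(Finset.mem_powersetCard.1 hS).2]

/-- Double counting: a set of size `g + 1` is `insert j S` for `g + 1` choices of `j`, and a set of
size `g` omits `n - g` elements. With `R` a rank, the bracket in the EXIT function becomes a sum of
rank increments. -/
theorem sum_powersetCard_succ_sub {n : ℕ} (R : Finset (Fin n) → ℝ) (g : ℕ) (hg : g ≤ n) :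
    ((g : ℝ) + 1) * ∑ S ∈ Finset.univ.powersetCard (g + 1), R S -
        ((n : ℝ) - g) * ∑ S ∈ Finset.univ.powersetCard g, R S =
      ∑ j, ∑ S ∈ (Finset.univ.erase j).powersetCard g, (R (insert j S) - R S) := by
  have h1 : ∑ j, ∑ S ∈ (Finset.univ.erase j).powersetCard g, R S =
      ((n : ℝ) - g) * ∑ S ∈ Finset.univ.powersetCard g, R S := by
    rw [Finset.sum_comm' (t' := Finset.univ.powersetCard g) (s' := fun S => Sᶜ), Finset.mul_sum]
    · refine Finset.sum_congr rfl fun S hS => ?_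
      rw [Finset.sum_const, Finset.card_compl, (Finset.mem_powersetCard.1 hS).2, nsmul_eq_mul,
        Fintype.card_fin, Nat.cast_sub hg]
    · intro j S
      simp [Finset.mem_powersetCard, Finset.subset_erase]
  have h2 : ∑ j, ∑ S ∈ (Finset.univ.erase j).powersetCard g, R (insert j S) =
      ((g : ℝ) + 1) * ∑ S ∈ Finset.univ.powersetCard (g + 1), R S := by
    have h3 : ∀ j : Fin n, ∑ S ∈ (Finset.univ.erase j).powersetCard g, R (insert j S) =
        ∑ U ∈ (Finset.univ.powersetCard (g + 1)).filter (j ∈ ·), R U := by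
      intro j
      refine Finset.sum_bij' (fun S _ => insert j S) (fun U _ => U.erase j) ?_ ?_ ?_ ?_ ?_
      · intro S hS
        simp only [Finset.mem_powersetCard, Finset.subset_erase] at hS
        simp [Finset.card_insert_of_notMem hS.1.2, hS.2]
      · intro U hU
        simp only [Finset.mem_filter, Finset.mem_powersetCard] at hU
        simp [Finset.mem_powersetCard, Finset.subset_erase, Finset.card_erase_of_mem hU.2, hU.1.2]
      · intro S hS
        simp only [Finset.mem_powersetCard, Finset.subset_erase] at hS
        exact Finset.erase_insert hS.1.2
      · intro U hU
        exact Finset.insert_erase (Finset.mem_filter.1 hU).2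
      · intro S hS
        rfl
    rw [Finset.sum_congr rfl fun j _ => h3 j,
      Finset.sum_comm' (t' := Finset.univ.powersetCard (g + 1)) (s' := fun S => S), Finset.mul_sum]
    · refine Finset.sum_congr rfl fun S hS => ?_
      rw [Finset.sum_const, (Finset.mem_powersetCard.1 hS).2, nsmul_eq_mul, Nat.cast_succ]
    · intro j S
      simp [and_comm]
  simp only [Finset.sum_sub_distrib]
  rw [h1, h2]

/-! ### EXIT functions as averaged bit erasure probabilities -/

namespace ComponentCode

variable (c : ComponentCode)

/-- The span of the columns of `[G | I]` selected by `S` and `T`. -/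
def colSpan (S : Finset (Fin c.n)) (T : Finset (Fin c.k)) :
    Submodule (ZMod 2) (Fin c.k → ZMod 2) :=
  Submodule.span (ZMod 2) (c.G.col '' S ∪ (fun i => Pi.single i 1) '' (T : Set (Fin c.k)))

theorem rank_fromCols (S : Finset (Fin c.n)) (T : Finset (Fin c.k)) :
    (Matrix.fromCols (c.G.submatrix id (fun j : S => (j : Fin c.n)))
      ((1 : Matrix (Fin c.k) (Fin c.k) (ZMod 2)).submatrix id
        (fun j : T => (j : Fin c.k)))).rank = Module.finrank (ZMod 2) (c.colSpan S T) := by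
  have h : Set.range (Matrix.fromCols (c.G.submatrix id (fun j : S => (j : Fin c.n)))
      ((1 : Matrix (Fin c.k) (Fin c.k) (ZMod 2)).submatrix id
        (fun j : T => (j : Fin c.k)))).col =
      c.G.col '' S ∪ (fun i => Pi.single i 1) '' (T : Set (Fin c.k)) := by
    have h1 : ∀ a : Fin c.k, (Pi.single a 1 : Fin c.k → ZMod 2) =
        fun i => (1 : Matrix (Fin c.k) (Fin c.k) (ZMod 2)) i a := fun a => by
      ext i
      simp [Matrix.one_apply, Pi.single_apply]
    ext x
    simp only [h1]
    constructor
    · rintro ⟨⟨a, ha⟩ | ⟨a, ha⟩, rfl⟩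
      · exact Or.inl ⟨a, ha, rfl⟩
      · exact Or.inr ⟨a, ha, rfl⟩
    · rintro (⟨a, ha, rfl⟩ | ⟨a, ha, rfl⟩)
      · exact ⟨Sum.inl ⟨a, ha⟩, rfl⟩
      · exact ⟨Sum.inr ⟨a, ha⟩, rfl⟩
  rw [Matrix.rank_eq_finrank_span_cols, h, colSpan]

open Classical in
/-- Indicator of the event that the code bit `j` cannot be recovered from the code bits in `S` and
the information bits in `T`. -/
noncomputable def undet (j : Fin c.n) (S : Finset (Fin c.n)) (T : Finset (Fin c.k)) : ℝ :=
  if c.G.col j ∈ c.colSpan S T then 0 else 1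

theorem undet_nonneg (j S T) : 0 ≤ c.undet j S T := by unfold undet; split_ifs <;> simp

theorem undet_le_one (j S T) : c.undet j S T ≤ 1 := by unfold undet; split_ifs <;> simp

theorem colSpan_mono {S S' T T'} (hS : S ⊆ S') (hT : T ⊆ T') : c.colSpan S T ≤ c.colSpan S' T' :=
  Submodule.span_mono (Set.union_subset_union (Set.image_mono hS) (Set.image_mono hT))

theorem undet_anti (j) {S S' T T'} (hS : S ⊆ S') (hT : T ⊆ T') :
    c.undet j S' T' ≤ c.undet j S T := by
  have := @c.colSpan_mono S S' T T' hS hT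
  unfold undet
  split_ifs with h1 h2 h2
  · exact le_rfl
  · exact zero_le_one
  · exact absurd (this h2) h1
  · exact le_rfl

theorem colSpan_insert (j : Fin c.n) (S : Finset (Fin c.n)) (T : Finset (Fin c.k)) :
    c.colSpan (insert j S) T = c.colSpan S T ⊔ Submodule.span (ZMod 2) {c.G.col j} := by
  rw [colSpan, colSpan, ← Submodule.span_union]
  congr 1
  rw [Finset.coe_insert, Set.image_insert_eq, Set.insert_union, Set.union_singleton]

theorem finrank_colSpan_insert (j : Fin c.n) (S : Finset (Fin c.n)) (T : Finset (Fin c.k)) :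
    (Module.finrank (ZMod 2) (c.colSpan (insert j S) T) : ℝ) -
      Module.finrank (ZMod 2) (c.colSpan S T) = c.undet j S T := by
  rw [colSpan_insert, undet]
  split_ifs with h
  · rw [sup_eq_left.2 ((Submodule.span_singleton_le_iff_mem _ _).2 h), sub_self]
  · rw [Submodule.finrank_sup_span_singleton h]
    push_cast
    ring

/-- Duality: a column lies outside a span iff some linear functional kills the span but not the
column. Functionals are dot products with information words `u`, so `u` witnesses an ambiguity
invisible on `S` and `T`. -/
theorem undet_eq (j : Fin c.n) (S : Finset (Fin c.n)) (T : Finset (Fin c.k)) [Decidable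
    (∃ u : Fin c.k → ZMod 2, (∀ s ∈ S, Matrix.vecMul u c.G s = 0) ∧ (∀ t ∈ T, u t = 0) ∧
      Matrix.vecMul u c.G j ≠ 0)] :
    c.undet j S T =
      if ∃ u : Fin c.k → ZMod 2, (∀ s ∈ S, Matrix.vecMul u c.G s = 0) ∧ (∀ t ∈ T, u t = 0) ∧
        Matrix.vecMul u c.G j ≠ 0 then 1 else 0 := by
  have key : c.G.col j ∉ c.colSpan S T ↔ ∃ u : Fin c.k → ZMod 2,
      (∀ s ∈ S, Matrix.vecMul u c.G s = 0) ∧ (∀ t ∈ T, u t = 0) ∧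
        Matrix.vecMul u c.G j ≠ 0 := by
    constructor
    · intro h
      obtain ⟨f, hf, hle⟩ := Submodule.exists_le_ker_of_notMem h
      obtain ⟨u, rfl⟩ := (dotProductEquiv (ZMod 2) (Fin c.k)).surjective f
      refine ⟨u, fun s hs => ?_, fun t ht => ?_, hf⟩
      · exact hle (Submodule.subset_span (Or.inl ⟨s, hs, rfl⟩))
      · simpa using hle (Submodule.subset_span (Or.inr ⟨t, ht, rfl⟩))
    · rintro ⟨u, hS, hT, hj⟩ hmem
      have hle : c.colSpan S T ≤ LinearMap.ker (dotProductEquiv (ZMod 2) (Fin c.k) u) := by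
        refine Submodule.span_le.2 ?_
        rintro _ (⟨s, hs, rfl⟩ | ⟨t, ht, rfl⟩)
        · exact hS s hs
        · simpa using hT t ht
      exact hj (hle hmem)
  unfold undet
  by_cases h : c.G.col j ∈ c.colSpan S T
  · rw [if_pos h, if_neg fun h' => key.2 h' h]
  · rw [if_neg h, if_pos (key.1 h)]

theorem splitInfoFun_eq (g h : ℕ) : (c.splitInfoFun g h : ℝ) =
    ∑ S ∈ (Finset.univ : Finset (Fin c.n)).powersetCard g,
      ∑ T ∈ (Finset.univ : Finset (Fin c.k)).powersetCard h,
        (Module.finrank (ZMod 2) (c.colSpan S T) : ℝ) := by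
  rw [splitInfoFun]
  push_cast
  exact Finset.sum_congr rfl fun S _ => Finset.sum_congr rfl fun T _ => by rw [rank_fromCols]

theorem infoFun_eq (g : ℕ) : c.infoFun g = c.splitInfoFun g 0 := by
  rw [infoFun, splitInfoFun]
  refine Finset.sum_congr rfl fun S _ => ?_
  have h : Set.range (c.G.submatrix id (fun j : S => (j : Fin c.n))).col = c.G.col '' S := by
    ext x
    constructor
    · rintro ⟨⟨a, ha⟩, rfl⟩
      exact ⟨a, ha, rfl⟩
    · rintro ⟨a, ha, rfl⟩
      exact ⟨⟨a, ha⟩, rfl⟩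
  rw [Finset.powersetCard_zero, Finset.sum_singleton, rank_fromCols,
    Matrix.rank_eq_finrank_span_cols, h, colSpan, Finset.coe_empty, Set.image_empty,
    Set.union_empty]

/-- At `q = 1` only `z = k` survives, so no information bit is known. Check nodes thus need no
separate analysis. -/
theorem exitVN_one (p : ℝ) : c.exitVN p 1 = c.exitCN p := by
  rw [exitVN, exitCN]
  congr 2
  refine Finset.sum_congr rfl fun t _ => ?_
  rw [Finset.sum_eq_single_of_mem c.k (Finset.mem_range.2 (Nat.lt_succ_self _))]
  · simp [infoFun_eq]
  · intro z hz hzk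
    have : c.k - z ≠ 0 := by have := Finset.mem_range.1 hz; omega
    simp [this]

/-- The probability that the code bit `j` is not recovered by MAP decoding. -/
noncomputable def bitErasure (j : Fin c.n) (q : ℝ) (S : Finset (Fin c.n)) : ℝ :=
  erasureMean Finset.univ (c.undet j S) q

/-- By `sum_powersetCard_succ_sub` each bracket is a sum of rank increments, and adding column `j`
raises the rank by exactly `undet j S T`. The powers of `p` and `q` are the erasure weights. -/
theorem one_sub_exitVN (p q : ℝ) : 1 - c.exitVN p q =
    1 / (c.n : ℝ) * ∑ j, erasureMean (Finset.univ.erase j) (c.bitErasure j q) p := by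
  rw [exitVN, sub_sub_cancel]
  congr 1
  have hcard : ∀ j : Fin c.n, (Finset.univ.erase j).card = c.n - 1 := fun j => by
    rw [Finset.card_erase_of_mem (Finset.mem_univ j), Finset.card_fin]
  have hR : ∀ j : Fin c.n, erasureMean (Finset.univ.erase j) (c.bitErasure j q) p =
      ∑ t ∈ Finset.range c.n, ∑ z ∈ Finset.range (c.k + 1),
        (∑ S ∈ (Finset.univ.erase j).powersetCard (c.n - 1 - t),
          ∑ T ∈ Finset.univ.powersetCard (c.k - z), c.undet j S T) *
        (p ^ t * (1 - p) ^ (c.n - 1 - t) * (q ^ z * (1 - q) ^ (c.k - z))) := by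
    intro j
    have hn : c.n - 1 + 1 = c.n := Nat.sub_add_cancel (Fin.pos j)
    rw [← erasureMean_eq_sum_range (hcard j), hn]
    refine Finset.sum_congr rfl fun t _ => ?_
    simp only [bitErasure, ← erasureMean_eq_sum_range (Finset.card_fin c.k)]
    rw [Finset.sum_comm, Finset.sum_mul]
    refine Finset.sum_congr rfl fun z _ => ?_
    rw [← Finset.sum_mul]
    ring
  rw [Fintype.sum_congr _ _ hR]
  conv_rhs => rw [Finset.sum_comm]
  refine Finset.sum_congr rfl fun t ht => ?_
  conv_rhs => rw [Finset.sum_comm]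
  refine Finset.sum_congr rfl fun z _ => ?_
  have ht' := Finset.mem_range.1 ht
  have key : ((c.n : ℝ) - t) * (c.splitInfoFun (c.n - t) (c.k - z) : ℝ)
        - ((t : ℝ) + 1) * (c.splitInfoFun (c.n - t - 1) (c.k - z) : ℝ) =
      ∑ j, ∑ S ∈ (Finset.univ.erase j).powersetCard (c.n - 1 - t),
          ∑ T ∈ Finset.univ.powersetCard (c.k - z), c.undet j S T := by
    have h := sum_powersetCard_succ_sub (fun S : Finset (Fin c.n) =>
      ∑ T ∈ Finset.univ.powersetCard (c.k - z),
        (Module.finrank (ZMod 2) (c.colSpan S T) : ℝ)) (c.n - 1 - t) (by omega)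
    simp only [← Finset.sum_sub_distrib, finrank_colSpan_insert] at h
    rw [← h, ← splitInfoFun_eq, ← splitInfoFun_eq]
    have e1 : c.n - 1 - t + 1 = c.n - t := by omega
    have e2 : c.n - t - 1 = c.n - 1 - t := by omega
    have e3 : (c.n : ℝ) = ((c.n - 1 - t : ℕ) : ℝ) + t + 1 := by
      have : c.n = c.n - 1 - t + t + 1 := by omega
      exact_mod_cast this
    rw [e1, e2, e3]
    ring
  rw [key, Nat.sub_right_comm, ← Finset.sum_mul]
  ring

end ComponentCode

/-! ### Weight-2 codewords and the slope at `p = 0` -/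

theorem ZMod.two_ne_zero_iff (a : ZMod 2) : a ≠ 0 ↔ a = 1 := by
  revert a; decide

theorem eq_single_add_single_iff {n : ℕ} (x : Fin n → ZMod 2) {j l : Fin n} (hjl : l ≠ j) :
    x = Pi.single j 1 + Pi.single l 1 ↔ Finset.univ.filter (fun i => x i ≠ 0) = {j, l} := by
  constructor
  · rintro rfl
    ext i
    by_cases hj : i = j
    · subst hj; simp [hjl.symm]
    · by_cases hl : i = l
      · subst hl; simp [Pi.single_apply, hj]
      · simp [Pi.single_apply, hj, hl]
  · intro h
    ext1 i
    have hi : x i ≠ 0 ↔ i = j ∨ i = l := by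
      have := Finset.ext_iff.1 h i
      simpa using this
    by_cases hj : i = j
    · subst hj
      rw [(ZMod.two_ne_zero_iff _).1 (hi.2 (Or.inl rfl))]
      simp [hjl.symm]
    · by_cases hl : i = l
      · subst hl
        rw [(ZMod.two_ne_zero_iff _).1 (hi.2 (Or.inr rfl))]
        simp [hj]
      · have h0 : x i = 0 := by
          by_contra h0
          rcases hi.1 h0 with h1 | h1
          · exact hj h1
          · exact hl h1
        simp [hj, hl, h0]

/-- A support of size 2 has two orderings `(j, l)`; this is the factor 2 in `2 A₂ / n`. -/
theorem sum_pairs_eq_two {n : ℕ} (x : Fin n → ZMod 2) :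
    ∑ j, ∑ l ∈ Finset.univ.erase j,
      (if x = Pi.single j 1 + Pi.single l 1 then (1 : ℝ) else 0) =
      if hammingNorm x = 2 then 2 else 0 := by
  classical
  have h1 : ∑ j, ∑ l ∈ Finset.univ.erase j,
      (if x = Pi.single j 1 + Pi.single l 1 then (1 : ℝ) else 0) =
      ((Finset.univ.filter fun a : Fin n × Fin n => a.2 ≠ a.1 ∧
        Finset.univ.filter (fun i => x i ≠ 0) = {a.1, a.2}).card : ℝ) := by
    rw [Finset.card_filter]
    push_cast
    rw [Fintype.sum_prod_type]
    refine Finset.sum_congr rfl fun j _ => ?_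
    rw [← Finset.sum_subset (Finset.erase_subset j Finset.univ)]
    · refine Finset.sum_congr rfl fun l hl => ?_
      have hl' := Finset.ne_of_mem_erase hl
      simp only [eq_single_add_single_iff x hl', hl', ne_eq, not_false_eq_true, true_and]
    · intro l _ hl
      have : l = j := by simpa using hl
      simp [this]
  rw [h1]
  split_ifs with h
  · have h2 : (Finset.univ.filter fun a : Fin n × Fin n => a.2 ≠ a.1 ∧
        Finset.univ.filter (fun i => x i ≠ 0) = {a.1, a.2}) =
        (Finset.univ.filter fun i => x i ≠ 0).offDiag := by
      ext ⟨a, b⟩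
      rw [Finset.mem_filter, Finset.mem_offDiag]
      constructor
      · rintro ⟨-, hab, hs⟩
        simp only at hab hs
        rw [hs]
        simp [hab.symm]
      · rintro ⟨ha, hb, hab⟩
        refine ⟨Finset.mem_univ _, hab.symm, (Finset.eq_of_subset_of_card_le ?_ ?_).symm⟩
        · simp only [Finset.insert_subset_iff, Finset.singleton_subset_iff]
          exact ⟨ha, hb⟩
        · rw [Finset.card_pair hab]
          exact h.le
    have h3 : (Finset.univ.filter fun i => x i ≠ 0).card = 2 := h
    rw [h2, Finset.offDiag_card, h3]
    norm_num
  · rw [Nat.cast_eq_zero, Finset.card_eq_zero, Finset.filter_eq_empty_iff]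
    rintro ⟨a, b⟩ - ⟨hab, hs⟩
    simp only at hab hs
    exact h (by rw [hammingNorm, hs, Finset.card_pair hab.symm])

namespace ComponentCode

variable (c : ComponentCode)

theorem two_le_hammingNorm {u : Fin c.k → ZMod 2} (hu : Matrix.vecMul u c.G ≠ 0) :
    2 ≤ hammingNorm (Matrix.vecMul u c.G) :=
  c.two_le_minDist.trans (Nat.sInf_le ⟨u, hu, rfl⟩)

theorem exists_ne_zero : ∃ u : Fin c.k → ZMod 2, Matrix.vecMul u c.G ≠ 0 := by
  obtain ⟨_, u, hu, -⟩ := Nat.nonempty_of_pos_sInf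
    (lt_of_lt_of_le two_pos c.two_le_minDist)
  exact ⟨u, hu⟩

theorem exists_col_ne_zero : ∃ (u : Fin c.k → ZMod 2) (j : Fin c.n), Matrix.vecMul u c.G j ≠ 0 := by
  obtain ⟨u, hu⟩ := c.exists_ne_zero
  obtain ⟨j, hj⟩ := Function.ne_iff.1 hu
  exact ⟨u, j, hj⟩

theorem n_pos : 0 < c.n := by
  obtain ⟨-, j, -⟩ := c.exists_col_ne_zero
  exact Fin.pos j

theorem n_cast_pos : (0 : ℝ) < c.n := Nat.cast_pos.2 c.n_pos

theorem vecMul_injective : Function.Injective fun u => Matrix.vecMul u c.G := by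
  rw [Matrix.vecMul_injective_iff, linearIndependent_iff_card_eq_finrank_span,
    Set.finrank, ← Matrix.rank_eq_finrank_span_row, c.rank_eq, Fintype.card_fin]

/-- A codeword supported in `{j, l}` and nonzero at `j` has full support `{j, l}`, since weight 1 is
excluded. -/
theorem vecMul_eq_iff (u : Fin c.k → ZMod 2) {j l : Fin c.n} (hjl : l ≠ j) :
    ((∀ s ∈ (Finset.univ.erase j).erase l, Matrix.vecMul u c.G s = 0) ∧
      Matrix.vecMul u c.G j ≠ 0) ↔ Matrix.vecMul u c.G = Pi.single j 1 + Pi.single l 1 := by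
  rw [eq_single_add_single_iff _ hjl]
  constructor
  · rintro ⟨h, hj⟩
    have hsub : Finset.univ.filter (fun i => Matrix.vecMul u c.G i ≠ 0) ⊆ {j, l} := by
      intro i hi
      by_contra hi'
      simp only [Finset.mem_insert, Finset.mem_singleton, not_or] at hi'
      exact (Finset.mem_filter.1 hi).2 (h i (by simp [hi'.1, hi'.2]))
    refine Finset.eq_of_subset_of_card_le hsub ?_
    rw [Finset.card_pair hjl.symm]
    exact c.two_le_hammingNorm fun h0 => hj (by rw [h0]; rfl)
  · intro h
    have hi : ∀ i, Matrix.vecMul u c.G i ≠ 0 ↔ i = j ∨ i = l := fun i => by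
      simpa using Finset.ext_iff.1 h i
    refine ⟨fun s hs => ?_, (hi j).2 (Or.inl rfl)⟩
    by_contra h0
    rcases (hi s).1 h0 with rfl | rfl
    · simp at hs
    · simp at hs

theorem undet_univ_erase (j : Fin c.n) (T : Finset (Fin c.k)) :
    c.undet j (Finset.univ.erase j) T = 0 := by
  classical
  rw [undet_eq, if_neg]
  rintro ⟨u, h, -, hj⟩
  have h2 := c.two_le_hammingNorm fun h0 => hj (by rw [h0]; rfl)
  have hsub : Finset.univ.filter (fun i => Matrix.vecMul u c.G i ≠ 0) ⊆ {j} := by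
    intro i hi
    by_contra hi'
    exact (Finset.mem_filter.1 hi).2 (h i (by simpa using hi'))
  have := Finset.card_le_card hsub
  rw [Finset.card_singleton] at this
  have h3 : hammingNorm (Matrix.vecMul u c.G) ≤ 1 := this
  omega

theorem undet_univ (j : Fin c.n) (S : Finset (Fin c.n)) : c.undet j S Finset.univ = 0 := by
  classical
  rw [undet_eq, if_neg]
  rintro ⟨u, -, h, hj⟩
  have : u = 0 := funext fun i => h i (Finset.mem_univ i)
  rw [this, Matrix.zero_vecMul] at hj
  exact hj rfl

theorem undet_empty_iff (j : Fin c.n) : c.undet j ∅ ∅ = 1 ↔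
    ∃ u : Fin c.k → ZMod 2, Matrix.vecMul u c.G j ≠ 0 := by
  classical
  rw [undet_eq]
  simp

theorem bitErasure_le_one (j) {q : ℝ} (hq : q ∈ Icc (0 : ℝ) 1) (S) : c.bitErasure j q S ≤ 1 := by
  have := erasureMean.mono (X := Finset.univ) hq fun T _ => c.undet_le_one j S T
  rwa [erasureMean.const] at this

theorem bitErasure_anti (j) {q : ℝ} (hq : q ∈ Icc (0 : ℝ) 1) : Antitone (c.bitErasure j q) :=
  fun _ _ h => erasureMean.mono hq fun _ _ => c.undet_anti j h subset_rfl

theorem bitErasure_mono (j) {q q' : ℝ} (hq : 0 ≤ q) (hqq : q ≤ q') (hq' : q' ≤ 1) (S) :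
    c.bitErasure j q S ≤ c.bitErasure j q' S :=
  erasureMean.monotone (fun _ _ h => c.undet_anti j subset_rfl h) hq hqq hq'

theorem exitVN_anti {p p' q q' : ℝ} (hp : 0 ≤ p) (hpp : p ≤ p') (hp' : p' ≤ 1) (hq : 0 ≤ q)
    (hqq : q ≤ q') (hq' : q' ≤ 1) : c.exitVN p' q' ≤ c.exitVN p q := by
  have : 1 - c.exitVN p q ≤ 1 - c.exitVN p' q' := by
    rw [one_sub_exitVN, one_sub_exitVN]
    refine mul_le_mul_of_nonneg_left (Finset.sum_le_sum fun j _ => ?_)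
      (one_div_nonneg.2 c.n_cast_pos.le)
    exact (erasureMean.mono ⟨hp, hpp.trans hp'⟩ fun S _ => c.bitErasure_mono j hq hqq hq' S).trans
      (erasureMean.monotone (c.bitErasure_anti j ⟨hq.trans hqq, hq'⟩) hp hpp hp')
  linarith

theorem exitVN_zero_left (q : ℝ) : c.exitVN 0 q = 1 := by
  have : 1 - c.exitVN 0 q = 0 := by
    rw [one_sub_exitVN, Finset.sum_eq_zero fun j _ => ?_, mul_zero]
    rw [erasureMean.zero, bitErasure,
      erasureMean.congr fun T _ => c.undet_univ_erase j T, erasureMean.const]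
  linarith

theorem exitVN_zero_right (p : ℝ) : c.exitVN p 0 = 1 := by
  have : 1 - c.exitVN p 0 = 0 := by
    rw [one_sub_exitVN, Finset.sum_eq_zero fun j _ => ?_, mul_zero]
    rw [erasureMean.congr (φ := fun _ => 0), erasureMean.const]
    intro S _
    rw [bitErasure, erasureMean.zero, undet_univ]
  linarith

/-- For `q < 1` all information bits are known with positive probability, and they determine every
code bit. -/
theorem exitVN_one_left_pos {q : ℝ} (hq : 0 ≤ q) (hq1 : q < 1) : 0 < c.exitVN 1 q := by
  have : 1 - c.exitVN 1 q < 1 := by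
    have hn := c.n_cast_pos
    rw [one_sub_exitVN, one_div, inv_mul_lt_iff₀ hn, mul_one]
    have h1 : ∀ j ∈ (Finset.univ : Finset (Fin c.n)),
        erasureMean (Finset.univ.erase j) (c.bitErasure j q) 1 < 1 := fun j _ => by
      rw [erasureMean.one, bitErasure]
      exact erasureMean.lt_one (ψ := c.undet j ∅) (fun T _ => c.undet_le_one j ∅ T)
        (c.undet_univ j ∅).le hq hq1
    have h2 := Finset.sum_lt_sum_of_nonempty
      (Finset.univ_nonempty_iff.2 (Fin.pos_iff_nonempty.1 c.n_pos)) h1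
    simpa using h2
  linarith

theorem exitVN_one_one_lt : c.exitVN 1 1 < 1 := by
  have : 0 < 1 - c.exitVN 1 1 := by
    rw [one_sub_exitVN]
    refine mul_pos (one_div_pos.2 c.n_cast_pos) ?_
    have h : ∀ j, erasureMean (Finset.univ.erase j) (c.bitErasure j 1) 1 = c.undet j ∅ ∅ :=
      fun j => by rw [erasureMean.one, bitErasure, erasureMean.one]
    obtain ⟨u, j, hj⟩ := c.exists_col_ne_zero
    refine Finset.sum_pos' (fun j _ => ?_) ⟨j, Finset.mem_univ j, ?_⟩
    · rw [h]; exact c.undet_nonneg _ _ _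
    · rw [h, (c.undet_empty_iff j).2 ⟨u, hj⟩]; exact one_pos
  linarith

/-- With only `j` and `l` unknown, the sole possible ambiguity is the codeword supported on `{j,
l}`. By full rank at most one `u` generates it, and it stays undetected iff the whole support of `u`
is erased, with probability `q ^ hammingNorm u`. -/
theorem bitErasure_pair (q : ℝ) {j l : Fin c.n} (hjl : l ≠ j) :
    c.bitErasure j q ((Finset.univ.erase j).erase l) =
      ∑ u : Fin c.k → ZMod 2, q ^ hammingNorm u *
        if Matrix.vecMul u c.G = Pi.single j 1 + Pi.single l 1 then 1 else 0 := by
  classical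
  have key : ∀ T, c.undet j ((Finset.univ.erase j).erase l) T =
      if ∃ u : Fin c.k → ZMod 2, Matrix.vecMul u c.G = Pi.single j 1 + Pi.single l 1 ∧
        ∀ t ∈ T, u t = 0 then 1 else 0 := fun T => by
    rw [undet_eq]
    congr 1
    refine propext (exists_congr fun u => ?_)
    rw [← c.vecMul_eq_iff u hjl]
    tauto
  by_cases hex : ∃ u : Fin c.k → ZMod 2, Matrix.vecMul u c.G = Pi.single j 1 + Pi.single l 1
  · obtain ⟨u, hu⟩ := hex
    have huniq : ∀ v : Fin c.k → ZMod 2,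
        Matrix.vecMul v c.G = Pi.single j 1 + Pi.single l 1 ↔ v = u :=
      fun v => ⟨fun hv => c.vecMul_injective (hv.trans hu.symm), fun hv => hv ▸ hu⟩
    simp only [huniq, exists_eq_left, mul_ite, mul_one, mul_zero, Finset.sum_ite_eq',
      Finset.mem_univ, if_true] at key ⊢
    rw [bitErasure, erasureMean.congr (φ := fun T =>
      if Disjoint T (Finset.univ.filter fun i => u i ≠ 0) then 1 else 0), erasureMean.disjoint
      (Finset.subset_univ _)]
    · rfl
    · intro T _
      rw [key]
      congr 1
      rw [Finset.disjoint_left]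
      simp
  · have hne : ∀ v : Fin c.k → ZMod 2,
        Matrix.vecMul v c.G ≠ Pi.single j 1 + Pi.single l 1 := fun v hv => hex ⟨v, hv⟩
    simp only [hne, false_and, exists_false, if_false, mul_zero, Finset.sum_const_zero] at key ⊢
    rw [bitErasure, erasureMean.congr fun T _ => key T, erasureMean.const]

/-- The information words that generate a codeword of weight `2`. -/
noncomputable def words2 : Finset (Fin c.k → ZMod 2) :=
  Finset.univ.filter fun u => hammingNorm (Matrix.vecMul u c.G) = 2

theorem A2_eq : c.A2 = c.words2.card := by
  rw [A2, ← Finset.card_image_of_injective _ c.vecMul_injective, ← Set.ncard_coe_finset]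
  congr 1
  ext x
  simp only [words2, Set.mem_ofPred_eq, Finset.coe_image, Set.mem_image, Finset.mem_coe,
    Finset.mem_filter, Finset.mem_univ, true_and]
  constructor
  · rintro ⟨hx, u, rfl⟩; exact ⟨u, hx, rfl⟩
  · rintro ⟨u, hx, rfl⟩; exact ⟨hx, u, rfl⟩

theorem A2u_eq (m : ℕ) : c.A2u m = (c.words2.filter fun u => hammingNorm u = m).card := by
  rw [A2u, ← Finset.card_image_of_injective _ c.vecMul_injective, ← Set.ncard_coe_finset]
  congr 1
  ext x
  simp only [words2, Set.mem_ofPred_eq, Finset.coe_image, Set.mem_image, Finset.mem_coe,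
    Finset.mem_filter, Finset.mem_univ, true_and]
  constructor
  · rintro ⟨hx, u, hu, rfl⟩; exact ⟨u, ⟨hx, hu⟩, rfl⟩
  · rintro ⟨u, ⟨hx, hu⟩, rfl⟩; exact ⟨hx, u, hu, rfl⟩

theorem hammingNorm_mem_Icc {u : Fin c.k → ZMod 2} (hu : u ∈ c.words2) :
    hammingNorm u ∈ Finset.Icc 1 c.k := by
  rw [Finset.mem_Icc, Nat.one_le_iff_ne_zero, Ne, hammingNorm_eq_zero]
  refine ⟨?_, (hammingNorm_le_card_fintype).trans_eq (Fintype.card_fin _)⟩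
  rintro rfl
  have h := (Finset.mem_filter.1 hu).2
  rw [Matrix.zero_vecMul, hammingNorm_zero] at h
  exact absurd h (by norm_num)

theorem Pi_eq (q : ℝ) : c.Pi q = 1 / (c.n : ℝ) * ∑ u ∈ c.words2, 2 * q ^ hammingNorm u := by
  rw [Pi, ← Finset.sum_fiberwise_of_maps_to (fun u hu => c.hammingNorm_mem_Icc hu), Finset.mul_sum]
  refine Finset.sum_congr rfl fun m _ => ?_
  rw [A2u_eq, Finset.sum_congr rfl fun u hu => by rw [(Finset.mem_filter.1 hu).2],
    Finset.sum_const, nsmul_eq_mul]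
  ring

theorem Ci_eq : c.Ci = c.Pi 1 := by
  rw [Pi_eq, Ci, A2_eq]
  simp
  ring

theorem hasDerivAt_exitVN_zero (q : ℝ) : HasDerivAt (fun p => c.exitVN p q) (-c.Pi q) 0 := by
  have h1 : ∀ j, HasDerivAt (erasureMean (Finset.univ.erase j) (c.bitErasure j q))
      (∑ l ∈ Finset.univ.erase j, c.bitErasure j q ((Finset.univ.erase j).erase l)) 0 := fun j =>
    erasureMean.hasDerivAt_zero _ _ (by
      rw [bitErasure, erasureMean.congr fun T _ => c.undet_univ_erase j T, erasureMean.const])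
  have h2 := ((HasDerivAt.fun_sum fun j (_ : j ∈ Finset.univ) => h1 j).const_mul
    (1 / (c.n : ℝ))).const_sub 1
  have h3 : (fun p => c.exitVN p q) = fun p => 1 - 1 / (c.n : ℝ) *
      ∑ j, erasureMean (Finset.univ.erase j) (c.bitErasure j q) p := by
    funext p
    rw [← one_sub_exitVN, sub_sub_cancel]
  rw [h3]
  refine h2.congr_deriv ?_
  rw [Pi_eq]
  congr 2
  calc _ = ∑ j, ∑ l ∈ Finset.univ.erase j, ∑ u : Fin c.k → ZMod 2, q ^ hammingNorm u *
        (if Matrix.vecMul u c.G = Pi.single j 1 + Pi.single l 1 then 1 else 0) :=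
        Finset.sum_congr rfl fun j _ => Finset.sum_congr rfl fun l hl =>
          c.bitErasure_pair q (Finset.ne_of_mem_erase hl)
    _ = ∑ u : Fin c.k → ZMod 2, q ^ hammingNorm u * ∑ j, ∑ l ∈ Finset.univ.erase j,
        (if Matrix.vecMul u c.G = Pi.single j 1 + Pi.single l 1 then 1 else 0) := by
        simp only [Finset.mul_sum]
        rw [Finset.sum_comm]
        refine Finset.sum_congr rfl fun j _ => ?_
        rw [Finset.sum_comm]
    _ = _ := by
        simp only [sum_pairs_eq_two, words2, Finset.sum_filter, mul_ite, mul_zero]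
        exact Finset.sum_congr rfl fun u _ => by rw [mul_comm]

theorem dmin_eq_two {u : Fin c.k → ZMod 2} (hu : u ∈ c.words2) : c.dmin = 2 := by
  have h := (Finset.mem_filter.1 hu).2
  refine le_antisymm (Nat.sInf_le ⟨u, fun h0 => ?_, h.symm⟩) c.two_le_minDist
  rw [h0, hammingNorm_zero] at h
  exact absurd h (by norm_num)

/-- Allows the filter `dmin = 2` to be dropped from the sums defining `C` and `P`. -/
theorem Pi_eq_zero (h : c.dmin ≠ 2) (q : ℝ) : c.Pi q = 0 := by
  rw [Pi_eq, Finset.sum_eq_zero fun u hu => absurd (c.dmin_eq_two hu) h, mul_zero]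

end ComponentCode

/-! ### Bounds, regularity and growth for one component code -/

namespace ComponentCode

variable (c : ComponentCode)

theorem exitVN_nonneg {p q : ℝ} (hp : p ∈ Icc (0 : ℝ) 1) (hq : q ∈ Icc (0 : ℝ) 1) :
    0 ≤ c.exitVN p q := by
  have : 1 - c.exitVN p q ≤ 1 := by
    rw [one_sub_exitVN, one_div, inv_mul_le_iff₀ c.n_cast_pos, mul_one]
    have h1 : ∀ j ∈ (Finset.univ : Finset (Fin c.n)),
        erasureMean (Finset.univ.erase j) (c.bitErasure j q) p ≤ 1 := fun j _ => by
      have := erasureMean.mono (X := Finset.univ.erase j) hp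
        fun S _ => c.bitErasure_le_one j hq S
      rwa [erasureMean.const] at this
    simpa using Finset.sum_le_sum h1
  linarith

theorem continuous_exitVN : Continuous fun x : ℝ × ℝ => c.exitVN x.1 x.2 := by
  unfold exitVN
  fun_prop

theorem contDiff_exitVN (q : ℝ) : ContDiff ℝ 1 fun p => c.exitVN p q := by
  unfold exitVN
  fun_prop

theorem exists_polynomial_exitCN :
    ∃ Q : Polynomial ℝ, ∀ p, c.exitCN p = Q.eval p :=
  ⟨1 - Polynomial.C (1 / (c.n : ℝ)) * ∑ t ∈ Finset.range c.n,
    Polynomial.C (((c.n : ℝ) - t) * (c.infoFun (c.n - t) : ℝ)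
        - ((t : ℝ) + 1) * (c.infoFun (c.n - t - 1) : ℝ))
      * Polynomial.X ^ t * (1 - Polynomial.X) ^ (c.n - t - 1), fun p => by
    simp [exitCN, Polynomial.eval_finsetSum]⟩

theorem Pi_nonneg {x : ℝ} (hx : 0 ≤ x) : 0 ≤ c.Pi x :=
  Finset.sum_nonneg fun _ _ => by positivity

theorem Pi_zero : c.Pi 0 = 0 :=
  Finset.sum_eq_zero fun u hu => by
    have : u ≠ 0 := by have := (Finset.mem_Icc.1 hu).1; omega
    rw [zero_pow this, mul_zero]

theorem Pi_mono {x y : ℝ} (hx : 0 ≤ x) (hxy : x ≤ y) : c.Pi x ≤ c.Pi y :=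
  Finset.sum_le_sum fun _ _ => by gcongr

theorem Pi_strictMono {z : ℝ} (hz : c.Pi z ≠ 0) {x y : ℝ} (hx : 0 ≤ x) (hxy : x < y) :
    c.Pi x < c.Pi y := by
  rw [Pi_eq] at hz
  obtain ⟨u, hu, -⟩ := Finset.exists_ne_zero_of_sum_ne_zero (right_ne_zero_of_mul hz)
  rw [Pi_eq, Pi_eq]
  refine mul_lt_mul_of_pos_left (Finset.sum_lt_sum (fun v _ => by gcongr) ⟨u, hu, ?_⟩)
    (one_div_pos.2 c.n_cast_pos)
  have := (Finset.mem_Icc.1 (c.hammingNorm_mem_Icc hu)).1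
  have := pow_lt_pow_left₀ hxy hx (Nat.one_le_iff_ne_zero.1 this)
  linarith

/-- Every exponent is at least 1, so growth is at least linear; this gives surjectivity of `P`. -/
theorem mul_Pi_one_le {x : ℝ} (hx : 1 ≤ x) : x * c.Pi 1 ≤ c.Pi x := by
  rw [Pi, Pi, Finset.mul_sum]
  refine Finset.sum_le_sum fun u hu => ?_
  have h : x ≤ x ^ u := le_self_pow₀ hx (by have := (Finset.mem_Icc.1 hu).1; omega)
  rw [one_pow, mul_one, mul_comm]
  exact mul_le_mul_of_nonneg_left h (by positivity)

theorem continuous_Pi : Continuous c.Pi := by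
  unfold Pi
  fun_prop

end ComponentCode

/-! ### Erasure maps of the ensemble -/

namespace DGLDPCEnsemble

variable (E : DGLDPCEnsemble)

/-- Erasure probability of the messages leaving the variable nodes. -/
noncomputable def vErasure (p q : ℝ) : ℝ := 1 - E.exitVND p q

/-- Erasure probability of the messages leaving the check nodes. -/
noncomputable def cErasure (p : ℝ) : ℝ := 1 - E.exitCND p

theorem vErasure_eq (p q : ℝ) :
    E.vErasure p q = ∑ i, E.lam i * (1 - (E.vn i).exitVN p q) := by
  simp only [mul_sub, mul_one, Finset.sum_sub_distrib, E.sum_lam, vErasure, exitVND]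

theorem cErasure_eq (p : ℝ) :
    E.cErasure p = ∑ i, E.rho i * (1 - (E.cn i).exitVN p 1) := by
  simp only [mul_sub, mul_one, Finset.sum_sub_distrib, E.sum_rho, cErasure, exitCND,
    ComponentCode.exitVN_one]

theorem vErasure_mono {p p' q q' : ℝ} (hp : 0 ≤ p) (hpp : p ≤ p') (hp' : p' ≤ 1) (hq : 0 ≤ q)
    (hqq : q ≤ q') (hq' : q' ≤ 1) : E.vErasure p q ≤ E.vErasure p' q' := by
  rw [vErasure_eq, vErasure_eq]
  exact Finset.sum_le_sum fun i _ => mul_le_mul_of_nonneg_left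
    (sub_le_sub_left ((E.vn i).exitVN_anti hp hpp hp' hq hqq hq') _) (E.lam_nonneg i)

theorem cErasure_mono {p p' : ℝ} (hp : 0 ≤ p) (hpp : p ≤ p') (hp' : p' ≤ 1) :
    E.cErasure p ≤ E.cErasure p' := by
  rw [cErasure_eq, cErasure_eq]
  exact Finset.sum_le_sum fun i _ => mul_le_mul_of_nonneg_left
    (sub_le_sub_left ((E.cn i).exitVN_anti hp hpp hp' zero_le_one le_rfl le_rfl) _)
    (E.rho_nonneg i)

theorem vErasure_zero_left (q : ℝ) : E.vErasure 0 q = 0 := by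
  simp [vErasure_eq, ComponentCode.exitVN_zero_left]

theorem vErasure_zero_right (p : ℝ) : E.vErasure p 0 = 0 := by
  simp [vErasure_eq, ComponentCode.exitVN_zero_right]

theorem cErasure_zero : E.cErasure 0 = 0 := by
  simp [cErasure_eq, ComponentCode.exitVN_zero_left]

theorem vErasure_mem {p q : ℝ} (hp : p ∈ Icc (0 : ℝ) 1) (hq : q ∈ Icc (0 : ℝ) 1) :
    E.vErasure p q ∈ Icc (0 : ℝ) 1 := by
  constructor
  · rw [← E.vErasure_zero_left q]
    exact E.vErasure_mono le_rfl hp.1 hp.2 hq.1 le_rfl hq.2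
  · have : 0 ≤ E.exitVND p q := Finset.sum_nonneg fun i _ =>
      mul_nonneg (E.lam_nonneg i) ((E.vn i).exitVN_nonneg hp hq)
    rw [vErasure]
    linarith

theorem cErasure_mem {p : ℝ} (hp : p ∈ Icc (0 : ℝ) 1) : E.cErasure p ∈ Icc (0 : ℝ) 1 := by
  constructor
  · rw [← E.cErasure_zero]
    exact E.cErasure_mono le_rfl hp.1 hp.2
  · have : 0 ≤ E.exitCND p := Finset.sum_nonneg fun i _ => by
      rw [← ComponentCode.exitVN_one]
      exact mul_nonneg (E.rho_nonneg i) ((E.cn i).exitVN_nonneg hp ⟨zero_le_one, le_rfl⟩)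
    rw [cErasure]
    linarith

theorem continuous_vErasure : Continuous fun x : ℝ × ℝ => E.vErasure x.1 x.2 := by
  simp only [vErasure_eq]
  have := fun i => (E.vn i).continuous_exitVN
  fun_prop

theorem contDiff_vErasure (q : ℝ) : ContDiff ℝ 1 fun p => E.vErasure p q := by
  simp only [vErasure_eq]
  have := fun i => (E.vn i).contDiff_exitVN q
  fun_prop

theorem contDiff_cErasure : ContDiff ℝ 1 E.cErasure := by
  rw [funext E.cErasure_eq]
  have := fun i => (E.cn i).contDiff_exitVN 1
  fun_prop

theorem P_eq (x : ℝ) : E.P x = ∑ i, E.lam i * (E.vn i).Pi x := by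
  rw [P, Finset.sum_filter]
  refine Finset.sum_congr rfl fun i _ => ?_
  split_ifs with h
  · rfl
  · rw [ComponentCode.Pi_eq_zero _ h, mul_zero]

theorem C_eq : E.C = ∑ i, E.rho i * (E.cn i).Pi 1 := by
  rw [C, Finset.sum_filter]
  refine Finset.sum_congr rfl fun i _ => ?_
  split_ifs with h
  · rw [ComponentCode.Ci_eq]
  · rw [ComponentCode.Pi_eq_zero _ h, mul_zero]

theorem C_nonneg : 0 ≤ E.C := by
  rw [C_eq]
  exact Finset.sum_nonneg fun i _ => mul_nonneg (E.rho_nonneg i) ((E.cn i).Pi_nonneg zero_le_one)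

theorem hasDerivAt_vErasure_zero (q : ℝ) : HasDerivAt (fun p => E.vErasure p q) (E.P q) 0 := by
  simp only [vErasure_eq, P_eq]
  refine HasDerivAt.fun_sum fun i _ => ?_
  simpa using (((E.vn i).hasDerivAt_exitVN_zero q).const_sub 1).const_mul (E.lam i)

theorem hasDerivAt_cErasure_zero : HasDerivAt E.cErasure E.C 0 := by
  rw [funext E.cErasure_eq, C_eq]
  refine HasDerivAt.fun_sum fun i _ => ?_
  simpa using (((E.cn i).hasDerivAt_exitVN_zero 1).const_sub 1).const_mul (E.rho i)

theorem vErasure_one_lt {q : ℝ} (hq : 0 ≤ q) (hq1 : q < 1) : E.vErasure 1 q < 1 := by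
  have h : ∑ i, E.lam i ≠ 0 := by rw [E.sum_lam]; exact one_ne_zero
  obtain ⟨i, -, hi⟩ := Finset.exists_ne_zero_of_sum_ne_zero h
  have : 0 < E.exitVND 1 q := Finset.sum_pos'
    (fun i _ => mul_nonneg (E.lam_nonneg i) ((E.vn i).exitVN_one_left_pos hq hq1).le)
    ⟨i, Finset.mem_univ i, mul_pos (lt_of_le_of_ne (E.lam_nonneg i) hi.symm)
      ((E.vn i).exitVN_one_left_pos hq hq1)⟩
  rw [vErasure]
  linarith

theorem cErasure_one_pos : 0 < E.cErasure 1 := by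
  have h : ∑ i, E.rho i ≠ 0 := by rw [E.sum_rho]; exact one_ne_zero
  obtain ⟨i, -, hi⟩ := Finset.exists_ne_zero_of_sum_ne_zero h
  rw [cErasure_eq]
  exact Finset.sum_pos'
    (fun i _ => mul_nonneg (E.rho_nonneg i) (sub_nonneg.2 (E.cn i).exitVN_one_one_lt.le))
    ⟨i, Finset.mem_univ i, mul_pos (lt_of_le_of_ne (E.rho_nonneg i) hi.symm)
      (sub_pos.2 (E.cn i).exitVN_one_one_lt)⟩

theorem exists_polynomial_cErasure : ∃ Q : Polynomial ℝ, ∀ p, E.cErasure p = Q.eval p := by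
  choose Q hQ using fun i => (E.cn i).exists_polynomial_exitCN
  exact ⟨1 - ∑ i, Polynomial.C (E.rho i) * Q i, fun p => by
    simp [cErasure, exitCND, hQ, Polynomial.eval_finsetSum]⟩

/-- A monotone polynomial that takes equal values at two points is constant between them, hence
constant everywhere. But `cErasure` is `0` at `0` and positive at `1`. -/
theorem cErasure_strictMonoOn : StrictMonoOn E.cErasure (Icc 0 1) := by
  intro x hx y hy hxy
  refine lt_of_le_of_ne (E.cErasure_mono hx.1 hxy.le hy.2) fun heq => ?_
  obtain ⟨Q, hQ⟩ := E.exists_polynomial_cErasure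
  have hconst : Q = Polynomial.C (E.cErasure x) := by
    refine Polynomial.eq_of_infinite_eval_eq _ _ ((Icc_infinite hxy).mono fun z hz => ?_)
    change Q.eval z = (Polynomial.C (E.cErasure x)).eval z
    rw [← hQ, Polynomial.eval_C]
    refine le_antisymm ?_ (E.cErasure_mono hx.1 hz.1 (hz.2.trans hy.2))
    rw [heq]
    exact E.cErasure_mono (hx.1.trans hz.1) hz.2 hy.2
  have h0 := E.cErasure_zero
  have h1 := E.cErasure_one_pos
  rw [hQ, hconst, Polynomial.eval_C] at h0 h1
  exact h1.ne' h0

/-! ### Slopes and tangency of the EXIT curves -/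

theorem curveC_eq (a : ℝ) : E.curveC a = 1 - E.cErasure (1 - a) := by
  rw [curveC, cErasure, sub_sub_cancel]

theorem curveV_eq (q a : ℝ) : E.curveV q a = 1 - E.vErasure (1 - a) q := by
  rw [curveV, vErasure, sub_sub_cancel]

theorem curveC_injOn : InjOn E.curveC (Icc 0 1) := by
  intro a ha b hb h
  rw [curveC_eq, curveC_eq, sub_right_inj] at h
  have := E.cErasure_strictMonoOn.injOn (x₁ := 1 - a) (x₂ := 1 - b)
    ⟨sub_nonneg.2 ha.2, by linarith [ha.1]⟩ ⟨sub_nonneg.2 hb.2, by linarith [hb.1]⟩ h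
  linarith

theorem invCurveC_curveC {a : ℝ} (ha : a ∈ Icc (0 : ℝ) 1) : E.invCurveC (E.curveC a) = a :=
  E.curveC_injOn.leftInvOn_invFunOn ha

theorem curveC_one : E.curveC 1 = 1 := by
  rw [curveC_eq, sub_self, cErasure_zero, sub_zero]

theorem hasDerivAt_curveC {a s : ℝ} (h : HasDerivAt E.cErasure s (1 - a)) :
    HasDerivAt E.curveC s a := by
  rw [funext E.curveC_eq]
  simpa using (h.comp a ((hasDerivAt_id a).const_sub 1)).const_sub 1

theorem hasDerivAt_curveV {q a s : ℝ} (h : HasDerivAt (fun p => E.vErasure p q) s (1 - a)) :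
    HasDerivAt (E.curveV q) s a := by
  rw [funext (E.curveV_eq q)]
  simpa using (HasDerivAt.comp (h₂ := fun p => E.vErasure p q) a h
    ((hasDerivAt_id a).const_sub 1)).const_sub 1

/-- Both curves are composed with `curveC`, so the inverse need not be differentiated: the chain
rule gives `P q * C = s * C` for the VND curve and `s * C = 1` for the inverse, whose composite is
the identity. In particular `C ≠ 0` comes for free. -/
theorem P_mul_C_of_sameSlope {q : ℝ} (h : E.SameSlope q 1) : E.P q * E.C = 1 := by
  obtain ⟨s, hV, hI⟩ := h
  have hu : UniqueDiffWithinAt ℝ (Icc (0 : ℝ) 1) 1 :=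
    uniqueDiffOn_Icc zero_lt_one 1 ⟨zero_le_one, le_rfl⟩
  have hC0 : HasDerivAt E.curveC E.C 1 :=
    E.hasDerivAt_curveC (by rw [sub_self]; exact E.hasDerivAt_cErasure_zero)
  have hV0 : HasDerivAt (E.curveV q) (E.P q) 1 :=
    E.hasDerivAt_curveV (by rw [sub_self]; exact E.hasDerivAt_vErasure_zero q)
  have hC : HasDerivWithinAt E.curveC E.C (Icc 0 1) 1 := hC0.hasDerivWithinAt
  have hmaps : MapsTo E.curveC (Icc 0 1) E.domInvC := mapsTo_image _ _
  rw [← E.curveC_one] at hV hI hV0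
  have h1 := hI.comp 1 hC hmaps
  have h2 := hV.comp 1 hC hmaps
  have h3 := hV0.comp_hasDerivWithinAt 1 hC
  have h4 : HasDerivWithinAt (E.invCurveC ∘ E.curveC) 1 (Icc 0 1) 1 :=
    (hasDerivWithinAt_id 1 _).congr (fun a ha => E.invCurveC_curveC ha)
      (E.invCurveC_curveC ⟨zero_le_one, le_rfl⟩)
  rw [hu.eq_deriv _ h3 h2, hu.eq_deriv _ h1 h4]

theorem tangentAt_of_deriv {p q s t : ℝ} (hp : p ∈ Ioo (0 : ℝ) 1) (hq : q ∈ Ico (0 : ℝ) 1)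
    (hfix : E.cErasure (E.vErasure p q) = p) (hs : HasDerivAt (fun p => E.vErasure p q) s p)
    (ht : HasDerivAt E.cErasure t (E.vErasure p q)) (hst : t * s = 1) :
    E.TangentAt q (1 - p) := by
  set x := E.vErasure p q with hx
  have hp' : p ∈ Icc (0 : ℝ) 1 := Ioo_subset_Icc_self hp
  have hq' : q ∈ Icc (0 : ℝ) 1 := Ico_subset_Icc_self hq
  have hx1 : x < 1 := lt_of_le_of_lt
    (E.vErasure_mono hp.1.le hp.2.le le_rfl hq.1 le_rfl hq.2.le) (E.vErasure_one_lt hq.1 hq.2)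
  have hx0 : 0 < x := lt_of_le_of_ne (E.vErasure_mem hp' hq').1 fun h0 => by
    rw [← h0, cErasure_zero] at hfix
    exact hp.1.ne hfix
  have hy : 1 - x ∈ Ioo (0 : ℝ) 1 := ⟨sub_pos.2 hx1, by linarith⟩
  have hCy : E.curveC (1 - x) = 1 - p := by rw [curveC_eq, sub_sub_cancel, hfix]
  have hyI : 1 - x ∈ Icc (0 : ℝ) 1 := Ioo_subset_Icc_self hy
  refine ⟨⟨1 - x, hyI, hCy⟩, ?_, s, ?_, ?_⟩
  · rw [← hCy, E.invCurveC_curveC hyI, hCy, curveV_eq, sub_sub_cancel]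
  · exact (E.hasDerivAt_curveV (by rwa [sub_sub_cancel])).hasDerivWithinAt
  · refine HasDerivAt.hasDerivWithinAt ?_
    have ht0 : t ≠ 0 := left_ne_zero_of_mul (hst.trans_ne one_ne_zero)
    have hd : HasDerivAt E.curveC t (1 - x) := E.hasDerivAt_curveC (by rwa [sub_sub_cancel])
    have hcd : ContDiff ℝ 1 E.curveC := by
      rw [funext E.curveC_eq]
      exact contDiff_const.sub (E.contDiff_cErasure.comp (contDiff_const.sub contDiff_id))
    have hsd : HasStrictDerivAt E.curveC t (1 - x) :=
      hcd.contDiffAt.hasStrictDerivAt' hd one_ne_zero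
    have hL := hsd.to_localInverse ht0
    have hr : ∀ᶠ z in 𝓝 (E.curveC (1 - x)),
        E.curveC (hsd.localInverse E.curveC t (1 - x) ht0 z) = z :=
      HasStrictFDerivAt.eventually_right_inverse _
    have hLy : hsd.localInverse E.curveC t (1 - x) ht0 (E.curveC (1 - x)) = 1 - x :=
      HasStrictFDerivAt.localInverse_apply_image _
    have hmem := hL.hasDerivAt.continuousAt.eventually
      (by rw [hLy]; exact Icc_mem_nhds hy.1 hy.2)
    -- Near this point the local inverse takes values in `[0, 1]`, where `curveC` is injective, so
    -- it agrees with `invCurveC`.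
    have heq : E.invCurveC =ᶠ[𝓝 (E.curveC (1 - x))]
        hsd.localInverse E.curveC t (1 - x) ht0 := by
      filter_upwards [hr, hmem] with z hz hz'
      rw [← E.invCurveC_curveC hz', hz]
    have := hL.hasDerivAt.congr_of_eventuallyEq heq
    rw [hCy] at this
    rwa [← eq_inv_of_mul_eq_one_right hst] at this

/-! ### Dynamics of the decoder -/

/-- One iteration of the decoder. -/
noncomputable def step (q p : ℝ) : ℝ := E.cErasure (E.vErasure p q)

theorem erasureProb_succ (q : ℝ) (l : ℕ) : E.erasureProb q (l + 1) = E.step q (E.erasureProb q l) :=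
  rfl

theorem step_zero (q : ℝ) : E.step q 0 = 0 := by rw [step, vErasure_zero_left, cErasure_zero]

theorem step_mono {p p' q q' : ℝ} (hp : 0 ≤ p) (hpp : p ≤ p') (hp' : p' ≤ 1) (hq : 0 ≤ q)
    (hqq : q ≤ q') (hq' : q' ≤ 1) : E.step q p ≤ E.step q' p' :=
  E.cErasure_mono (E.vErasure_mem ⟨hp, hpp.trans hp'⟩ ⟨hq, hqq.trans hq'⟩).1
    (E.vErasure_mono hp hpp hp' hq hqq hq')
    (E.vErasure_mem ⟨hp.trans hpp, hp'⟩ ⟨hq.trans hqq, hq'⟩).2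

theorem step_mem {p q : ℝ} (hp : p ∈ Icc (0 : ℝ) 1) (hq : q ∈ Icc (0 : ℝ) 1) :
    E.step q p ∈ Icc (0 : ℝ) 1 := E.cErasure_mem (E.vErasure_mem hp hq)

theorem continuous_step : Continuous fun x : ℝ × ℝ => E.step x.2 x.1 :=
  E.contDiff_cErasure.continuous.comp E.continuous_vErasure

theorem continuous_step_left (q : ℝ) : Continuous (E.step q) :=
  E.continuous_step.comp₂ continuous_id (continuous_const (y := q))

theorem continuous_step_right (p : ℝ) : Continuous fun q => E.step q p :=
  E.continuous_step.comp₂ (continuous_const (y := p)) continuous_id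

theorem hasDerivAt_step_zero (q : ℝ) : HasDerivAt (E.step q) (E.C * E.P q) 0 := by
  have h := E.hasDerivAt_cErasure_zero
  rw [← E.vErasure_zero_left q] at h
  exact HasDerivAt.comp (h := fun p => E.vErasure p q) 0 h (E.hasDerivAt_vErasure_zero q)

theorem erasureProb_mem {q : ℝ} (hq : q ∈ Icc (0 : ℝ) 1) (l : ℕ) :
    E.erasureProb q l ∈ Icc (0 : ℝ) 1 := by
  induction l with
  | zero => exact ⟨zero_le_one, le_rfl⟩
  | succ l ih => exact E.step_mem ih hq

theorem erasureProb_antitone {q : ℝ} (hq : q ∈ Icc (0 : ℝ) 1) : Antitone (E.erasureProb q) := by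
  refine antitone_nat_of_succ_le fun l => ?_
  induction l with
  | zero => exact (E.erasureProb_mem hq 1).2
  | succ l ih =>
    exact E.step_mono (E.erasureProb_mem hq _).1 ih (E.erasureProb_mem hq l).2 hq.1 le_rfl hq.2

theorem eventually_slope_step (q : ℝ) :
    Tendsto (fun p => p⁻¹ * E.step q p) (𝓝[>] 0) (𝓝 (E.C * E.P q)) := by
  have h := (E.hasDerivAt_step_zero q).tendsto_slope_zero_right
  simpa [step_zero] using h

theorem exists_step_lt {q : ℝ} (h : E.C * E.P q < 1) :
    ∃ δ > 0, ∀ p, 0 < p → p < δ → E.step q p < p := by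
  have := (E.eventually_slope_step q).eventually_lt_const h
  obtain ⟨δ, hδ, hs⟩ := mem_nhdsGT_iff_exists_Ioo_subset.1 this
  refine ⟨δ, hδ, fun p hp hpδ => ?_⟩
  have : p⁻¹ * E.step q p < 1 := hs ⟨hp, hpδ⟩
  rwa [inv_mul_lt_iff₀ hp, mul_one] at this

theorem exists_lt_step {q : ℝ} (h : 1 < E.C * E.P q) :
    ∃ δ > 0, ∀ p, 0 < p → p < δ → p < E.step q p := by
  have := (E.eventually_slope_step q).eventually_const_lt h
  obtain ⟨δ, hδ, hs⟩ := mem_nhdsGT_iff_exists_Ioo_subset.1 this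
  refine ⟨δ, hδ, fun p hp hpδ => ?_⟩
  have : 1 < p⁻¹ * E.step q p := hs ⟨hp, hpδ⟩
  rwa [lt_inv_mul_iff₀ hp, mul_one] at this

/-- The erasure probabilities are positive and antitone, but once below `δ` the next one would be
strictly larger. -/
theorem not_tendsto_of_one_lt {q : ℝ} (hq : q ∈ Icc (0 : ℝ) 1) (h : 1 < E.C * E.P q) :
    ¬ Tendsto (E.erasureProb q) atTop (𝓝 0) := by
  intro ht
  obtain ⟨δ, hδ, hs⟩ := E.exists_lt_step h
  have hpos : ∀ l, 0 < E.erasureProb q l := by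
    intro l
    induction l with
    | zero => exact zero_lt_one
    | succ l ih =>
      -- The value is cut down below `δ`, where `step` is known to increase; monotonicity transfers
      -- positivity back.
      have hm : 0 < min (E.erasureProb q l) (δ / 2) := lt_min ih (half_pos hδ)
      have h1 := hs _ hm ((min_le_right _ _).trans_lt (half_lt_self hδ))
      exact hm.trans (h1.trans_le (E.step_mono hm.le (min_le_left _ _)
        (E.erasureProb_mem hq l).2 hq.1 le_rfl hq.2))
  obtain ⟨l, hl⟩ := (ht.eventually_lt_const hδ).exists
  exact absurd (E.erasureProb_antitone hq l.le_succ) (not_le.2 (hs _ (hpos l) hl))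

theorem tendsto_of_step_lt {q : ℝ} (hq : q ∈ Icc (0 : ℝ) 1)
    (h : ∀ p, 0 < p → p ≤ 1 → E.step q p < p) : Tendsto (E.erasureProb q) atTop (𝓝 0) := by
  have hlim := tendsto_atTop_ciInf (E.erasureProb_antitone hq)
    ⟨0, by rintro _ ⟨l, rfl⟩; exact (E.erasureProb_mem hq l).1⟩
  set L := ⨅ l, E.erasureProb q l
  have hL : L ∈ Icc (0 : ℝ) 1 :=
    isClosed_Icc.mem_of_tendsto hlim (Eventually.of_forall (E.erasureProb_mem hq))
  have h1 : Tendsto (fun l => E.step q (E.erasureProb q l)) atTop (𝓝 (E.step q L)) :=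
    ((E.continuous_step_left q).tendsto L).comp hlim
  have h2 : Tendsto (fun l => E.erasureProb q (l + 1)) atTop (𝓝 L) :=
    (tendsto_add_atTop_iff_nat 1).2 hlim
  simp only [erasureProb_succ] at h2
  have h3 : L = 0 := by
    by_contra h0
    exact (h L (lt_of_le_of_ne hL.1 (Ne.symm h0)) hL.2).ne (tendsto_nhds_unique h1 h2)
  rwa [h3] at hlim

/-- A nonzero fixed point of the decoder at a channel parameter where the iteration is stable at
`0` entails a tangency at a smaller or equal channel parameter. -/
theorem exists_tangentAt {q p : ℝ} (hq : q ∈ Ico (0 : ℝ) 1) (hstab : E.C * E.P q < 1)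
    (hp0 : 0 < p) (hp1 : p ≤ 1) (hpq : p ≤ E.step q p) :
    ∃ q₀, 0 ≤ q₀ ∧ q₀ ≤ q ∧ ∃ a, E.TangentAt q₀ a := by
  obtain ⟨δ, hδ, hs⟩ := E.exists_step_lt hstab
  have hδp : δ ≤ p := by
    by_contra! h
    exact absurd (hs p hp0 h) (not_lt.2 hpq)
  -- Stability at `q` keeps the bad points at distance `δ` from `p = 0`, so they form a compact set,
  -- on which the channel parameter attains a minimum `q₀`.
  have hK : IsCompact ((Icc δ 1 ×ˢ Icc 0 q) ∩ {x : ℝ × ℝ | x.1 ≤ E.step x.2 x.1}) :=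
    (isCompact_Icc.prod isCompact_Icc).inter_right (isClosed_le continuous_fst E.continuous_step)
  obtain ⟨⟨p₀, q₀⟩, ⟨⟨hp₀, hq₀⟩, hle⟩, hmin⟩ := hK.exists_isMinOn
    ⟨(p, q), ⟨⟨hδp, hp1⟩, ⟨hq.1, le_rfl⟩⟩, hpq⟩ continuous_snd.continuousOn
  simp only [Set.mem_ofPred_eq] at hp₀ hq₀ hle
  have hp₀pos : 0 < p₀ := hδ.trans_le hp₀.1
  have hq₀1 : q₀ < 1 := hq₀.2.trans_lt hq.2
  have hbelow : ∀ q', 0 ≤ q' → q' < q₀ → ∀ p', 0 < p' → p' ≤ 1 → E.step q' p' ≤ p' := by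
    intro q' hq' hlt p' hp' hp'1
    by_contra! hcon
    rcases lt_or_ge p' δ with hd | hd
    · have h1 := E.step_mono hp'.le le_rfl hp'1 hq' (hlt.le.trans hq₀.2) hq.2.le
      linarith [hs p' hp' hd]
    · have h1 : q₀ ≤ q' := hmin (a := (p', q'))
        ⟨⟨⟨hd, hp'1⟩, ⟨hq', hlt.le.trans hq₀.2⟩⟩, hcon.le⟩
      exact absurd hlt (not_lt.2 h1)
  have hq₀pos : 0 < q₀ := lt_of_le_of_ne hq₀.1 fun h0 => by
    rw [← h0, step, vErasure_zero_right, cErasure_zero] at hle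
    exact absurd hle (not_le.2 hp₀pos)
  -- The inequality below `q₀` passes to the limit, so at `q₀` the graph lies under the diagonal and
  -- meets it at `p₀`.
  have hat : ∀ p', 0 < p' → p' ≤ 1 → E.step q₀ p' ≤ p' := by
    intro p' hp' hp'1
    refine le_of_tendsto ((E.continuous_step_right p').continuousWithinAt (s := Iio q₀) (x := q₀)) ?_
    filter_upwards [Ioo_mem_nhdsLT hq₀pos] with q' hq'
    exact hbelow q' hq'.1.le hq'.2 p' hp' hp'1
  have hfix : E.step q₀ p₀ = p₀ := le_antisymm (hat p₀ hp₀pos hp₀.2) hle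
  -- At `p₀ = 1` the fixed-point equation fails: `vErasure 1 q₀ < 1`, and strict monotonicity of
  -- `cErasure` gives `step q₀ 1 < 1`.
  have hp₀1 : p₀ < 1 := lt_of_le_of_ne hp₀.2 fun h1 => by
    rw [h1] at hfix
    have hv := E.vErasure_one_lt hq₀.1 hq₀1
    have h2 := E.cErasure_strictMonoOn
      (E.vErasure_mem ⟨zero_le_one, le_rfl⟩ ⟨hq₀.1, hq₀1.le⟩) ⟨zero_le_one, le_rfl⟩ hv
    have h3 := (E.cErasure_mem ⟨zero_le_one, le_rfl⟩).2
    rw [step] at hfix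
    linarith
  have hs' := ((E.contDiff_vErasure q₀).differentiable one_ne_zero p₀).hasDerivAt
  have ht' := (E.contDiff_cErasure.differentiable one_ne_zero (E.vErasure p₀ q₀)).hasDerivAt
  have hcomp : HasDerivAt (E.step q₀) _ p₀ :=
    HasDerivAt.comp (h := fun p => E.vErasure p q₀) p₀ ht' hs'
  have hmax : IsLocalMax (fun p => E.step q₀ p - p) p₀ := by
    filter_upwards [Ioo_mem_nhds hp₀pos hp₀1] with p' hp'
    rw [hfix, sub_self]
    exact sub_nonpos.2 (hat p' hp'.1 hp'.2.le)
  have hzero := hmax.hasDerivAt_eq_zero (hcomp.sub (hasDerivAt_id p₀))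
  exact ⟨q₀, hq₀.1, hq₀.2, 1 - p₀, E.tangentAt_of_deriv ⟨hp₀pos, hp₀1⟩ ⟨hq₀.1, hq₀1⟩ hfix hs' ht'
    (sub_eq_zero.1 hzero)⟩

/-! ### Inverting `P` and locating the threshold -/

theorem P_zero : E.P 0 = 0 := by simp [P_eq, ComponentCode.Pi_zero]

theorem continuous_P : Continuous E.P := by
  rw [funext E.P_eq]
  have := fun i => (E.vn i).continuous_Pi
  fun_prop

theorem P_strictMonoOn {q : ℝ} (h : E.P q ≠ 0) : StrictMonoOn E.P (Ici 0) := by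
  intro x hx y _ hxy
  rw [P_eq] at h
  obtain ⟨i, hi, hne⟩ := Finset.exists_ne_zero_of_sum_ne_zero h
  rw [P_eq, P_eq]
  exact Finset.sum_lt_sum (fun j _ => mul_le_mul_of_nonneg_left ((E.vn j).Pi_mono hx hxy.le)
    (E.lam_nonneg j)) ⟨i, hi, mul_lt_mul_of_pos_left
      ((E.vn i).Pi_strictMono (right_ne_zero_of_mul hne) hx hxy)
      (lt_of_le_of_ne (E.lam_nonneg i) (left_ne_zero_of_mul hne).symm)⟩

theorem P_bijOn {q : ℝ} (h : E.P q ≠ 0) : BijOn E.P (Ici 0) (Ici 0) := by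
  have hs := E.P_strictMonoOn h
  refine ⟨fun x hx => ?_, hs.injOn, fun y (hy : 0 ≤ y) => ?_⟩
  · change 0 ≤ E.P x
    rw [← E.P_zero]
    exact hs.monotoneOn self_mem_Ici hx hx
  · have h1 : 0 < E.P 1 := by
      rw [← E.P_zero]
      exact hs self_mem_Ici (mem_Ici.2 zero_le_one) zero_lt_one
    -- Chosen so that `x * P 1 ≥ y` and the linear lower bound on `P` applies.
    set x := max 1 (y / E.P 1)
    have hx : 1 ≤ x := le_max_left _ _
    have hyx : y ≤ E.P x := by
      have h2 : y ≤ x * E.P 1 := (div_le_iff₀ h1).1 (le_max_right _ _)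
      refine h2.trans ?_
      rw [P_eq, P_eq, Finset.mul_sum]
      refine Finset.sum_le_sum fun i _ => ?_
      rw [mul_left_comm]
      exact mul_le_mul_of_nonneg_left ((E.vn i).mul_Pi_one_le hx) (E.lam_nonneg i)
    obtain ⟨z, hz, hzy⟩ := intermediate_value_Icc (zero_le_one.trans hx)
      E.continuous_P.continuousOn (show y ∈ Icc (E.P 0) (E.P x) by
        rw [E.P_zero]; exact ⟨hy, hyx⟩)
    exact ⟨z, hz.1, hzy⟩

theorem threshold_nonneg : 0 ≤ E.threshold := Real.sSup_nonneg fun _ h => h.1.1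

theorem threshold_eq_of_first_tangency {q₁ : ℝ} (hq₁ : q₁ ∈ Icc (0 : ℝ) 1)
    (hPC : E.P q₁ * E.C = 1) (hno : ∀ q, 0 ≤ q → q < q₁ → ∀ a, ¬ E.TangentAt q a) :
    E.threshold = q₁ := by
  have hP : E.P q₁ ≠ 0 := left_ne_zero_of_mul (hPC.trans_ne one_ne_zero)
  have hC : 0 < E.C := lt_of_le_of_ne E.C_nonneg
    (right_ne_zero_of_mul (hPC.trans_ne one_ne_zero)).symm
  have hmono := E.P_strictMonoOn hP
  have hconv : ∀ q, 0 ≤ q → q < q₁ →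
      q ∈ {q : ℝ | q ∈ Icc (0 : ℝ) 1 ∧ Tendsto (E.erasureProb q) atTop (𝓝 0)} := by
    intro q hq hlt
    have hq1 : q < 1 := hlt.trans_le hq₁.2
    refine ⟨⟨hq, hq1.le⟩, E.tendsto_of_step_lt ⟨hq, hq1.le⟩ fun p hp0 hp1 => ?_⟩
    by_contra! hcon
    have hstab : E.C * E.P q < 1 := by
      rw [← hPC, mul_comm]
      exact mul_lt_mul_of_pos_right (hmono hq hq₁.1 hlt) hC
    obtain ⟨q₀, h0, hle, a, ha⟩ := E.exists_tangentAt ⟨hq, hq1⟩ hstab hp0 hp1 hcon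
    exact hno q₀ h0 (hle.trans_lt hlt) a ha
  have hpos : 0 < q₁ := lt_of_le_of_ne hq₁.1 fun h0 => hP (by rw [← h0, E.P_zero])
  refine le_antisymm (csSup_le ⟨0, hconv 0 le_rfl hpos⟩ fun q hq => ?_)
    (le_of_forall_lt_imp_le_of_dense fun q hq => ?_)
  · by_contra! hlt
    refine E.not_tendsto_of_one_lt hq.1 ?_ hq.2
    rw [← hPC, mul_comm]
    exact mul_lt_mul_of_pos_left (hmono hq₁.1 hq.1.1 hlt) hC
  -- The real `q < q₁` may be negative, hence the truncation at `0`.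
  · exact (le_max_left q 0).trans (le_csSup ⟨1, fun x hx => hx.1.2⟩
      (hconv (max q 0) (le_max_right _ _) (max_lt hq hpos)))

end DGLDPCEnsemble

theorem mainTheorem2 (E : DGLDPCEnsemble)
    (h : E.DerivativeMatching ∨ E.FirstTangencyAtOne) :
    0 < E.C ∧ StrictMonoOn E.P (Set.Ici 0) ∧ Set.BijOn E.P (Set.Ici 0) (Set.Ici 0) ∧
      E.threshold = E.Pinv (1 / E.C) := by
  have hPC : E.P E.threshold * E.C = 1 := by
    rcases h with h | ⟨q₁, hq₁, ht, hno⟩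
    · exact E.P_mul_C_of_sameSlope h
    · have h1 := E.P_mul_C_of_sameSlope ht.2.2
      rwa [E.threshold_eq_of_first_tangency hq₁ h1 hno]
  have hP : E.P E.threshold ≠ 0 := left_ne_zero_of_mul (hPC.trans_ne one_ne_zero)
  have hC : E.C ≠ 0 := right_ne_zero_of_mul (hPC.trans_ne one_ne_zero)
  refine ⟨lt_of_le_of_ne E.C_nonneg hC.symm, E.P_strictMonoOn hP, E.P_bijOn hP, ?_⟩
  rw [← eq_one_div_of_mul_eq_one_left hPC]
  exact ((E.P_strictMonoOn hP).injOn.leftInvOn_invFunOn E.threshold_nonneg).symm
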